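/- Let $(\Theta,\|\cdot\|)$ be a real Banach space (possibly infinite dimensional) with its Borel $\sigma$-algebra, $\Pi$ a prior probability measure on $\Theta$, and $\{P_\theta:\theta\in\Theta\}$ probability measures on a measurable space with densities $p_\theta\ge 0$ with respect to a common measure, $(\theta,y)\mapsto p_\theta(y)$ being jointly measurable. Fix $\theta_0\in\Theta$ and let $Y_1,Y_2,\dots$ be i.i.d. with law $P_{\theta_0}$. Suppose that for every $n$, almost surely $0<\int\prod_{i\le n}p_\theta(Y_i)\,\Pi(d\theta)<\infty$, so that the posterior $$\Pi(d\theta\mid Y_1,\dots,Y_n)=\frac{\prod_{i\le n}p_\theta(Y_i)\,\Pi(d\theta)}{\int\prod_{i\le n}p_{\theta'}(Y_i)\,\Pi(d\theta')}$$ is defined; write $\pi(\cdot\mid Y_1,\dots,Y_n)$ for its density, and $E_{[\theta\mid Y_1,\dots,Y_n]}$ for expectation under it. Let $M>0$ and $\varepsilon_n\to0$ be such that: 1. $\Pi(\|\theta-\theta_0\|>M\varepsilon_n\mid Y_1,\dots,Y_n)\to0$ in probability as $n\to\infty$; 2. for $Y\sim P_{\theta_0}$ independent of $Y_1,\dots,Y_n$,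 $$\max\Big[E_{[\theta\mid Y_1,\dots,Y_n]}\{p_\theta(Y)\,I(\|\theta-\theta_0\|>M\varepsilon_n)\},\ E_{[\theta\mid Y_1,\dots,Y_n]}\{\log p_\theta(Y)\,I(\|\theta-\theta_0\|>M\varepsilon_n)\}\Big]\to0$$ in probability (expectations in the extended real line, $\log 0=-\infty$); 3. for $P_{\theta_0}$-almost every $y$, $\theta\mapsto\log p_\theta(y)$ is finite in a neighbourhood of $\theta_0$ and Fréchet differentiable at $\theta_0$, with derivative $A_y$, and $E_{\theta_0}\|A_Y\|<\infty$ for the operator norm and $Y\sim P_{\theta_0}$. Then, as $n\to\infty$, $$\|\pi(\cdot\mid Y_1,\dots,Y_n)-\pi(\cdot\mid Y_1,\dots,Y_{n-1})\|_1\to0\quad\text{in probability}.$$ Moreover, for every $d_0$ and every $d_0$-dimensional component $\xi=\xi(\theta)\in\mathbb R^{d_0}$ of $\theta$ (any measurable function of $\theta$), the marginal posteriors satisfy $$\|\pi_\xi(\cdot\mid Y_1,\dots,Y_n)-\pi_\xi(\cdot\mid Y_1,\dots,Y_{n-1})\|_1\to0\quad\text{in probability}.$$ Here $\|\cdot\|_1$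 is the $L_1$ distance of the densities of the two distributions with respect to any common dominating measure. -/

import Mathlib

open MeasureTheory ProbabilityTheory Filter Topology
open scoped ENNReal NNReal

namespace BayesModel

section Convergence

variable {Ω : Type*} [MeasurableSpace Ω]

/-- The nonnegative random quantities `X n` converge to `0` in `Pr`-probability as `n → ∞`. -/
def TendstoZeroInProb (Pr : Measure Ω) (X : ℕ → Ω → ℝ≥0∞) : Prop :=
  ∀ δ : ℝ≥0∞, 0 < δ → Tendsto (fun n => Pr {ω | δ ≤ X n ω}) atTop (𝓝 0)

/-- The `L₁` distance `∫ |dμ/dlam - dν/dlam| dlam` of two finite measures, with the dominating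
measure `lam = μ + ν` (the value is the same for every σ-finite dominating measure). -/
noncomputable def l1Dist (μ ν : Measure Ω) : ℝ≥0∞ :=
  ∫⁻ x, ‖(μ.rnDeriv (μ + ν) x).toReal - (ν.rnDeriv (μ + ν) x).toReal‖ₑ ∂(μ + ν)

/-- The extended-real expectation `E f⁺ - E f⁻` of an extended-real function. -/
noncomputable def extExpect (μ : Measure Ω) (f : Ω → EReal) : EReal :=
  ((∫⁻ x, (f x).toENNReal ∂μ : ℝ≥0∞) : EReal) - ((∫⁻ x, (-f x).toENNReal ∂μ : ℝ≥0∞) : EReal)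

end Convergence

section Model

variable {Θ 𝒴 : Type*} [MeasurableSpace Θ] [MeasurableSpace 𝒴]

/-- The sampling distribution `P_θ`, with density `p θ` with respect to `ν`. -/
noncomputable def sampling (ν : Measure 𝒴) (p : Θ → 𝒴 → ℝ≥0) (θ : Θ) : Measure 𝒴 :=
  ν.withDensity (fun y => (p θ y : ℝ≥0∞))

/-- The likelihood of the first `n` observations `y 0, …, y (n - 1)`. -/
noncomputable def likelihood (p : Θ → 𝒴 → ℝ≥0) (n : ℕ) (y : ℕ → 𝒴) (θ : Θ) : ℝ≥0∞ :=
  ∏ i ∈ Finset.range n, (p θ (y i) : ℝ≥0∞)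

/-- The normalizing constant `∫ ∏ p_θ(y_i) Π(dθ)` of the posterior. -/
noncomputable def evidence (prior : Measure Θ) (p : Θ → 𝒴 → ℝ≥0) (n : ℕ) (y : ℕ → 𝒴) : ℝ≥0∞ :=
  ∫⁻ θ, likelihood p n y θ ∂prior

/-- The posterior distribution given the first `n` observations: its density with respect to the
prior is the likelihood divided by the normalizing constant. -/
noncomputable def posteriorLaw (prior : Measure Θ) (p : Θ → 𝒴 → ℝ≥0) (n : ℕ) (y : ℕ → 𝒴) :
    Measure Θ :=
  (evidence prior p n y)⁻¹ • prior.withDensity (likelihood p n y)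

end Model

section Conditions

variable {Θ 𝒴 Ω : Type*} [NormedAddCommGroup Θ] [NormedSpace ℝ Θ] [MeasurableSpace Θ]
  [MeasurableSpace 𝒴] [MeasurableSpace Ω]

/-- The parameters at distance more than `r` from `θ₀`. -/
def far (θ₀ : Θ) (r : ℝ) : Set Θ := {θ | r < ‖θ - θ₀‖}

/-- The posterior contracts at `θ₀` at rate `ε n`, with constant `M`. -/
def ContractsAtRate (Pr : Measure Ω) (Y : ℕ → Ω → 𝒴) (prior : Measure Θ) (p : Θ → 𝒴 → ℝ≥0)
    (θ₀ : Θ) (M : ℝ) (ε : ℕ → ℝ) : Prop :=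
  TendstoZeroInProb Pr
    (fun n ω => posteriorLaw prior p n (fun i => Y i ω) (far θ₀ (M * ε n)))

/-- `E[p_θ(y) I(θ ∈ F)]` for `θ` distributed as `μ`. -/
noncomputable def tailDensity (p : Θ → 𝒴 → ℝ≥0) (μ : Measure Θ) (F : Set Θ) (y : 𝒴) : ℝ≥0∞ :=
  ∫⁻ θ in F, (p θ y : ℝ≥0∞) ∂μ

/-- `E[log p_θ(y) I(θ ∈ F)]` for `θ` distributed as `μ`, with `log 0 = -∞`. -/
noncomputable def tailLog (p : Θ → 𝒴 → ℝ≥0) (μ : Measure Θ) (F : Set Θ) (y : 𝒴) : EReal :=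
  extExpect (μ.restrict F) (fun θ => ENNReal.log (p θ y : ℝ≥0∞))

/-- The larger of the two posterior tail expectations, of `p_θ(Y)` and of `log p_θ(Y)`, tends to
`0` in probability, where the new observation `Y` has law `P₀` and is independent of the sample:
the pair (sample, new observation) lives on the product space. -/
def TailCondition (Pr : Measure Ω) (Y : ℕ → Ω → 𝒴) (prior : Measure Θ) (p : Θ → 𝒴 → ℝ≥0)
    (P₀ : Measure 𝒴) (θ₀ : Θ) (M : ℝ) (ε : ℕ → ℝ) : Prop :=
  TendstoZeroInProb (Pr.prod P₀) (fun n z =>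
    (max
      (tailDensity p (posteriorLaw prior p n (fun i => Y i z.1)) (far θ₀ (M * ε n)) z.2 : EReal)
      (tailLog p (posteriorLaw prior p n (fun i => Y i z.1)) (far θ₀ (M * ε n)) z.2)).abs)

/-- For `P₀`-almost every `y`, the log-likelihood `θ ↦ log p_θ(y)` is finite near `θ₀` and Fréchet
differentiable at `θ₀`, and the operator norm of the derivative is `P₀`-integrable. -/
def LogLikelihoodDifferentiable (p : Θ → 𝒴 → ℝ≥0) (P₀ : Measure 𝒴) (θ₀ : Θ) : Prop :=
  ∃ A : 𝒴 → (Θ →L[ℝ] ℝ),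
    (∀ᵐ y ∂P₀, (∀ᶠ θ in 𝓝 θ₀, 0 < p θ y) ∧
      HasFDerivAt (fun θ => Real.log (p θ y)) (A y) θ₀) ∧
    Integrable (fun y => ‖A y‖) P₀

end Conditions

end BayesModel

namespace BayesModel

set_option linter.unusedSectionVars false

/-! ### Convergence in probability and the `L₁` distance. -/

section Convergence

variable {Ω : Type*} [MeasurableSpace Ω] {Pr : Measure Ω} {X Z : ℕ → Ω → ℝ≥0∞}

/-! By Bayes' rule, the posterior after `Y n` is the posterior before it, reweighted by `θ ↦ p θ (Y
n)` and normalized (`posteriorLaw_succ`). If this factor is within `D` of the constant `a = p θ₀ (Y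
n)` in posterior mean, and `D < a / 2`, then no event changes mass by more than `4 * D / a`
(`posteriorLaw_succ_close`), and the `L₁` distance is at most twice that (`l1Dist_le_two_mul`). A
marginal law only sees fewer events, so it obeys the same bound.

It remains to show that `D / a`, the `relDeviation`, tends to `0` in probability. For an observation
independent of the sample, split the posterior mean at radius `M * ε n`. Near `θ₀` the density is
continuous, being the exponential of a differentiable function, so the contribution vanishes almost
surely. Far from `θ₀`, `|p_θ - a| ≤ p_θ + a` leaves the tail expectation of the density and `a`
times the posterior mass, both controlled by assumption (`tendstoZeroInProb_relDeviation`). Since `Y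
n` is independent of the first `n` observations, the conclusion passes to the actual sequence
(`measure_next_eq_prod`). -/

theorem TendstoZeroInProb.mono (hX : TendstoZeroInProb Pr X) (h : ∀ n, ∀ᵐ ω ∂Pr, Z n ω ≤ X n ω) :
    TendstoZeroInProb Pr Z := by
  intro δ hδ
  refine tendsto_of_tendsto_of_tendsto_of_le_of_le tendsto_const_nhds (hX δ hδ)
    (fun _ => zero_le) (fun n => ?_)
  refine measure_mono_ae ?_
  filter_upwards [h n] with ω hω hδω
  exact le_trans hδω hω

theorem TendstoZeroInProb.add (hX : TendstoZeroInProb Pr X) (hZ : TendstoZeroInProb Pr Z) :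
    TendstoZeroInProb Pr (fun n ω => X n ω + Z n ω) := by
  intro δ hδ
  have hδ2 : 0 < δ / 2 := ENNReal.half_pos hδ.ne'
  have hlim := (hX _ hδ2).add (hZ _ hδ2)
  rw [add_zero] at hlim
  refine tendsto_of_tendsto_of_tendsto_of_le_of_le tendsto_const_nhds hlim
    (fun _ => zero_le) (fun n => ?_)
  refine (measure_mono ?_).trans (measure_union_le _ _)
  intro ω hω
  by_contra hcon
  simp only [Set.mem_union, Set.mem_ofPred_eq, not_or, not_le] at hcon hω
  have := ENNReal.add_lt_add hcon.1 hcon.2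
  rw [ENNReal.add_halves] at this
  exact absurd hω (not_le.mpr this)

/-- Convergence to `0` in probability survives multiplication by a fixed a.s. finite variable. -/
theorem TendstoZeroInProb.mul_const [IsFiniteMeasure Pr] (hX : TendstoZeroInProb Pr X)
    {h : Ω → ℝ≥0∞} (hh : AEMeasurable h Pr) (hfin : ∀ᵐ ω ∂Pr, h ω ≠ ∞) :
    TendstoZeroInProb Pr (fun n ω => X n ω * h ω) := by
  intro δ hδ
  -- An a.s. finite variable is tight: `h` exceeds a large `k` only with small probability.
  have hlarge : Tendsto (fun k : ℕ => Pr {ω | (k : ℝ≥0∞) < h ω}) atTop (𝓝 0) := by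
    have hlim := tendsto_measure_iInter_atTop (μ := Pr) (s := fun k : ℕ => {ω | (k : ℝ≥0∞) < h ω})
      (fun k => nullMeasurableSet_lt aemeasurable_const hh)
      (fun i j hij ω hω => by
        simp only [Set.mem_ofPred_eq] at hω ⊢
        exact lt_of_le_of_lt (by exact_mod_cast hij) hω)
      ⟨0, measure_ne_top _ _⟩
    have hzero : Pr (⋂ k : ℕ, {ω | (k : ℝ≥0∞) < h ω}) = 0 := by
      refine measure_mono_null ?_ (ae_iff.mp hfin)
      intro ω hω hne
      obtain ⟨k, hk⟩ := ENNReal.exists_nat_gt hne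
      exact absurd (Set.mem_iInter.mp hω k) (not_lt.mpr hk.le)
    rwa [hzero] at hlim
  rw [ENNReal.tendsto_atTop_zero]
  intro η hη
  have hη2 : 0 < η / 2 := ENNReal.half_pos hη.ne'
  obtain ⟨k, hk⟩ := (hlarge.eventually (ge_mem_nhds hη2)).exists
  -- Where `h ≤ k`, the product is at most `X n * (k + 1)`; the `+ 1` keeps the divisor nonzero.
  have hsmall := hX (δ / (k + 1)) (ENNReal.div_pos hδ.ne' (by simp))
  obtain ⟨N, hN⟩ := ENNReal.tendsto_atTop_zero.mp hsmall _ hη2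
  refine ⟨N, fun n hn => ?_⟩
  refine (measure_mono (t := {ω | δ / (k + 1) ≤ X n ω} ∪ {ω | (k : ℝ≥0∞) < h ω}) ?_).trans
    ((measure_union_le _ _).trans ((add_le_add (hN n hn) hk).trans_eq (ENNReal.add_halves _)))
  intro ω hω
  by_contra hcon
  simp only [Set.mem_union, Set.mem_ofPred_eq, not_or, not_le, not_lt] at hcon hω
  have h1 : X n ω * (k + 1) < δ := by
    rw [ENNReal.lt_div_iff_mul_lt (by simp) (by simp)] at hcon
    exact hcon.1
  have h2 : X n ω * h ω ≤ X n ω * (k + 1) := by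
    gcongr
    exact hcon.2.trans le_self_add
  exact absurd (hω.trans h2) (not_le.mpr h1)

theorem tendstoZeroInProb_of_tendsto_ae [IsFiniteMeasure Pr] (hX : ∀ n, AEMeasurable (X n) Pr)
    (h : ∀ᵐ ω ∂Pr, Tendsto (fun n => X n ω) atTop (𝓝 0)) : TendstoZeroInProb Pr X := by
  intro δ hδ
  have hnull : ∀ n, NullMeasurableSet {ω | δ ≤ X n ω} Pr := fun n =>
    nullMeasurableSet_le aemeasurable_const (hX n)
  have hlim := tendsto_lintegral_of_dominated_convergence' (μ := Pr)
    (F := fun n => {ω | δ ≤ X n ω}.indicator 1) (f := fun _ => 0) (fun _ => 1)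
    (fun n => aemeasurable_one.indicator₀ (hnull n))
    (fun n => ae_of_all _ fun ω => Set.indicator_le_self' (fun _ _ => zero_le) ω) (by simp) ?_
  · simpa [lintegral_indicator_one₀ (hnull _)] using hlim
  · filter_upwards [h] with ω hω
    refine tendsto_const_nhds.congr' ?_
    filter_upwards [hω.eventually (gt_mem_nhds hδ)] with n hn
    exact (Set.indicator_of_notMem (by simpa using hn) _).symm

/-- On each side of `{g ≤ f}` the integrand has constant sign, so its integral is a difference of
masses of a single event, hence at most `K`. -/
theorem l1Dist_le_two_mul {μ ν : Measure Ω} [IsFiniteMeasure μ] [IsFiniteMeasure ν] {K : ℝ≥0∞}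
    (h₁ : ∀ A, MeasurableSet A → μ A ≤ ν A + K) (h₂ : ∀ A, MeasurableSet A → ν A ≤ μ A + K) :
    l1Dist μ ν ≤ 2 * K := by
  have hμ : μ ≪ μ + ν := Measure.absolutelyContinuous_of_le (Measure.le_add_right le_rfl)
  have hν : ν ≪ μ + ν := Measure.absolutelyContinuous_of_le (Measure.le_add_left le_rfl)
  set f := μ.rnDeriv (μ + ν) with hf
  set g := ν.rnDeriv (μ + ν) with hg
  have hfm : Measurable f := Measure.measurable_rnDeriv _ _
  have hgm : Measurable g := Measure.measurable_rnDeriv _ _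
  have hone_side : ∀ (μ' ν' : Measure Ω) [IsFiniteMeasure μ'] [IsFiniteMeasure ν']
      (f g : Ω → ℝ≥0∞) (A : Set Ω), Measurable g →
      (∫⁻ x in A, f x ∂(μ + ν) = μ' A) → (∫⁻ x in A, g x ∂(μ + ν) = ν' A) →
      μ' A ≤ ν' A + K → (∀ x ∈ A, g x ≤ f x) → MeasurableSet A →
      ∫⁻ x in A, (f x - g x) ∂(μ + ν) ≤ K := by
    intro μ' ν' _ _ f g A hgm hfA hgA hle hgf hA
    rw [lintegral_sub hgm (by rw [hgA]; exact measure_ne_top _ _)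
      ((ae_restrict_iff' hA).mpr (ae_of_all _ hgf)), hfA, hgA]
    exact tsub_le_iff_left.mpr hle
  have hA : MeasurableSet {x | g x ≤ f x} := measurableSet_le hgm hfm
  have hsetf : ∀ A, ∫⁻ x in A, f x ∂(μ + ν) = μ A := fun A => Measure.setLIntegral_rnDeriv hμ A
  have hsetg : ∀ A, ∫⁻ x in A, g x ∂(μ + ν) = ν A := fun A => Measure.setLIntegral_rnDeriv hν A
  have key : ∀ (f g : Ω → ℝ≥0∞) (x : Ω), f x < ∞ → g x < ∞ → g x ≤ f x →
      ‖(f x).toReal - (g x).toReal‖ₑ ≤ f x - g x := by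
    intro f g x hfx hgx hle
    rw [← ENNReal.toReal_sub_of_le hle hfx.ne, Real.enorm_of_nonneg ENNReal.toReal_nonneg,
      ENNReal.ofReal_toReal (ne_top_of_le_ne_top hfx.ne tsub_le_self)]
  have hfin : ∀ᵐ x ∂(μ + ν), f x < ∞ ∧ g x < ∞ := by
    filter_upwards [Measure.rnDeriv_lt_top μ (μ + ν), Measure.rnDeriv_lt_top ν (μ + ν)] with x h h'
    exact ⟨h, h'⟩
  unfold l1Dist
  rw [← lintegral_add_compl _ hA, two_mul]
  refine add_le_add ?_ ?_
  · refine le_trans (lintegral_mono_ae ?_) (hone_side μ ν f g _ hgm (hsetf _) (hsetg _) (h₁ _ hA)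
      (fun x hx => hx) hA)
    filter_upwards [ae_restrict_of_ae hfin, ae_restrict_mem hA] with x hx hxA
    exact key f g x hx.1 hx.2 hxA
  · refine le_trans (lintegral_mono_ae ?_) (hone_side ν μ g f _ hfm (hsetg _) (hsetf _)
      (h₂ _ hA.compl) (fun x hx => by simpa using le_of_not_ge (by simpa using hx)) hA.compl)
    filter_upwards [ae_restrict_of_ae hfin, ae_restrict_mem hA.compl] with x hx hxA
    rw [← enorm_neg, neg_sub]
    have hlt : f x < g x := by simpa using hxA
    exact key g f x hx.2 hx.1 hlt.le

end Convergence

/-! ### Reweighting by a nearly constant density. -/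

section Reweighting

variable {Θ : Type*} [MeasurableSpace Θ]

/-- Reweighting a probability measure by a density that is within `D` of a constant `a` in `L₁`
moves the mass of every event by at most `2 D / c`, with `c` the normalizing constant. -/
theorem reweight_close {μ : Measure Θ} [IsProbabilityMeasure μ] {g d : Θ → ℝ≥0∞} {a c : ℝ≥0∞}
    (hg : Measurable g) (hc : ∫⁻ θ, g θ ∂μ = c) (hc0 : c ≠ 0) (hctop : c ≠ ∞)
    (h₁ : ∀ θ, g θ ≤ a + d θ) (h₂ : ∀ θ, a ≤ g θ + d θ) (A : Set Θ) (hA : MeasurableSet A) :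
    (c⁻¹ • μ.withDensity g) A ≤ μ A + 2 * (∫⁻ θ, d θ ∂μ) / c ∧
      μ A ≤ (c⁻¹ • μ.withDensity g) A + 2 * (∫⁻ θ, d θ ∂μ) / c := by
  set D := ∫⁻ θ, d θ ∂μ with hD
  have hset₁ : ∀ B, ∫⁻ θ in B, g θ ∂μ ≤ a * μ B + D := by
    intro B
    calc ∫⁻ θ in B, g θ ∂μ ≤ ∫⁻ θ in B, (a + d θ) ∂μ := lintegral_mono fun θ => h₁ θ
      _ = a * μ B + ∫⁻ θ in B, d θ ∂μ := by
        rw [lintegral_add_left measurable_const, setLIntegral_const]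
      _ ≤ a * μ B + D := by gcongr; exact setLIntegral_le_lintegral _ _
  have hset₂ : ∀ B, a * μ B ≤ ∫⁻ θ in B, g θ ∂μ + D := by
    intro B
    calc a * μ B = ∫⁻ _ in B, a ∂μ := by rw [setLIntegral_const]
      _ ≤ ∫⁻ θ in B, (g θ + d θ) ∂μ := lintegral_mono fun θ => h₂ θ
      _ = ∫⁻ θ in B, g θ ∂μ + ∫⁻ θ in B, d θ ∂μ := lintegral_add_left hg _
      _ ≤ ∫⁻ θ in B, g θ ∂μ + D := by gcongr; exact setLIntegral_le_lintegral _ _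
  -- The whole space as event shows that `a` and `c` differ by at most `D`. Replacing `g` by `a` on
  -- `A` costs one `D`, and replacing `a` by `c` costs the other.
  have hac : a ≤ c + D := by simpa [hc] using hset₂ Set.univ
  have hca : c ≤ a + D := by simpa [hc] using hset₁ Set.univ
  have hval : (c⁻¹ • μ.withDensity g) A = (∫⁻ θ in A, g θ ∂μ) / c := by
    rw [Measure.smul_apply, withDensity_apply _ hA, smul_eq_mul, mul_comm, ENNReal.div_eq_inv_mul,
      mul_comm]
  have hμA : μ A ≤ 1 := prob_le_one
  have hDA : D * μ A ≤ D := mul_le_of_le_one_right zero_le hμA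
  have hcancel : ∀ x : ℝ≥0∞, x = c * x / c := fun x => by
    rw [mul_comm, ENNReal.mul_div_cancel_right hc0 hctop]
  rw [hval]
  constructor
  · rw [hcancel (μ A), ← ENNReal.add_div]
    gcongr
    calc ∫⁻ θ in A, g θ ∂μ ≤ a * μ A + D := hset₁ A
      _ ≤ (c + D) * μ A + D := by gcongr
      _ = c * μ A + (D * μ A + D) := by ring
      _ ≤ c * μ A + (D + D) := by gcongr
      _ = c * μ A + 2 * D := by rw [two_mul]
  · rw [← ENNReal.add_div]
    conv_lhs => rw [hcancel (μ A)]
    gcongr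
    calc c * μ A ≤ (a + D) * μ A := by gcongr
      _ = a * μ A + D * μ A := by ring
      _ ≤ (∫⁻ θ in A, g θ ∂μ + D) + D := add_le_add (hset₂ A) hDA
      _ = ∫⁻ θ in A, g θ ∂μ + 2 * D := by rw [add_assoc, two_mul]

theorem NNReal.coe_le_coe_add_edist (a b : ℝ≥0) : (a : ℝ≥0∞) ≤ b + edist a b := by
  rw [edist_nndist]
  norm_cast
  rw [← NNReal.coe_le_coe, NNReal.coe_add, coe_nndist, NNReal.dist_eq]
  linarith [le_abs_self ((a : ℝ) - b)]

theorem NNReal.edist_le_coe_add (a b : ℝ≥0) : edist a b ≤ (a : ℝ≥0∞) + b := by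
  rw [edist_nndist]
  norm_cast
  rw [← NNReal.coe_le_coe, NNReal.coe_add, coe_nndist, NNReal.dist_eq]
  exact abs_sub_le_iff.mpr ⟨by linarith [b.coe_nonneg], by linarith [a.coe_nonneg]⟩

end Reweighting

/-! ### Bayesian updating by one observation. -/

section Posterior

variable {Θ 𝒴 : Type*} [MeasurableSpace Θ] [MeasurableSpace 𝒴]
  {prior : Measure Θ} {p : Θ → 𝒴 → ℝ≥0}

theorem measurable_coe_density (hp : Measurable (Function.uncurry p)) (y : 𝒴) :
    Measurable (fun θ => (p θ y : ℝ≥0∞)) :=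
  measurable_coe_nnreal_ennreal.comp (hp.comp (measurable_id.prodMk measurable_const))

theorem measurable_likelihood (hp : Measurable (Function.uncurry p)) (n : ℕ) (y : ℕ → 𝒴) :
    Measurable (likelihood p n y) :=
  Finset.measurable_prod _ fun i _ => measurable_coe_density hp (y i)

theorem measurable_likelihood_joint (hp : Measurable (Function.uncurry p)) (n : ℕ) :
    Measurable (fun z : (ℕ → 𝒴) × Θ => likelihood p n z.1 z.2) := by
  refine Finset.measurable_prod _ fun i _ => measurable_coe_nnreal_ennreal.comp ?_
  exact hp.comp (measurable_snd.prodMk ((measurable_pi_apply i).comp measurable_fst))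

theorem likelihood_succ (n : ℕ) (y : ℕ → 𝒴) :
    likelihood p (n + 1) y = likelihood p n y * fun θ => (p θ (y n) : ℝ≥0∞) := by
  ext θ
  simp [likelihood, Finset.prod_range_succ]

theorem posteriorLaw_congr {n : ℕ} {y y' : ℕ → 𝒴} (h : ∀ i < n, y i = y' i) :
    posteriorLaw prior p n y = posteriorLaw prior p n y' := by
  have hlik : likelihood p n y = likelihood p n y' := by
    ext θ
    exact Finset.prod_congr rfl fun i hi => by rw [h i (Finset.mem_range.mp hi)]
  simp only [posteriorLaw, evidence, hlik]

theorem posteriorLaw_univ (n : ℕ) (y : ℕ → 𝒴) :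
    posteriorLaw prior p n y Set.univ = (evidence prior p n y)⁻¹ * evidence prior p n y := by
  simp [posteriorLaw, evidence]

/-- No condition on the evidence is needed: if it is `0` or `∞`, the total mass is `0` by the
conventions of `ℝ≥0∞`. -/
theorem posteriorLaw_le_one (n : ℕ) (y : ℕ → 𝒴) (A : Set Θ) : posteriorLaw prior p n y A ≤ 1 :=
  (measure_mono (Set.subset_univ A)).trans <| by
    rw [posteriorLaw_univ]
    exact ENNReal.inv_mul_le_one _

theorem isProbabilityMeasure_posteriorLaw {n : ℕ} {y : ℕ → 𝒴} (h0 : evidence prior p n y ≠ 0)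
    (htop : evidence prior p n y ≠ ∞) : IsProbabilityMeasure (posteriorLaw prior p n y) :=
  ⟨by rw [posteriorLaw_univ, ENNReal.inv_mul_cancel h0 htop]⟩

theorem lintegral_posteriorLaw (hp : Measurable (Function.uncurry p)) (n : ℕ) (y : ℕ → 𝒴)
    {f : Θ → ℝ≥0∞} (hf : Measurable f) :
    ∫⁻ θ, f θ ∂posteriorLaw prior p n y =
      (evidence prior p n y)⁻¹ * ∫⁻ θ, likelihood p n y θ * f θ ∂prior := by
  rw [posteriorLaw, lintegral_smul_measure,
    lintegral_withDensity_eq_lintegral_mul _ (measurable_likelihood hp n y) hf]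
  rfl

/-- Updating the posterior by one observation. -/
theorem posteriorLaw_succ (hp : Measurable (Function.uncurry p)) {n : ℕ} {y : ℕ → 𝒴}
    (h0 : evidence prior p n y ≠ 0) (htop : evidence prior p n y ≠ ∞) :
    posteriorLaw prior p (n + 1) y =
      (∫⁻ θ, (p θ (y n) : ℝ≥0∞) ∂posteriorLaw prior p n y)⁻¹ •
        (posteriorLaw prior p n y).withDensity (fun θ => (p θ (y n) : ℝ≥0∞)) := by
  have hev : ∫⁻ θ, (p θ (y n) : ℝ≥0∞) ∂posteriorLaw prior p n y =
      (evidence prior p n y)⁻¹ * evidence prior p (n + 1) y := by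
    rw [lintegral_posteriorLaw hp n y (measurable_coe_density hp _), evidence.eq_def _ _ (n + 1),
      likelihood_succ]
    rfl
  rw [hev, posteriorLaw, posteriorLaw, withDensity_smul_measure, ← withDensity_mul _
    (measurable_likelihood hp n y) (measurable_coe_density hp _), ← likelihood_succ, smul_smul,
    ENNReal.mul_inv (Or.inl (ENNReal.inv_ne_zero.mpr htop)) (Or.inl (ENNReal.inv_ne_top.mpr h0)),
    inv_inv, mul_right_comm, ENNReal.mul_inv_cancel h0 htop, one_mul]

/-- The posterior varies with the sample, but its integrals are quotients of integrals against the
fixed prior, to which Tonelli applies. -/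
theorem measurable_lintegral_posteriorLaw [SFinite prior] (hp : Measurable (Function.uncurry p))
    (n : ℕ) {f : 𝒴 → Θ → ℝ≥0∞} (hf : Measurable (Function.uncurry f)) :
    Measurable (fun z : (ℕ → 𝒴) × 𝒴 => ∫⁻ θ, f z.2 θ ∂posteriorLaw prior p n z.1) := by
  have hrw : (fun z : (ℕ → 𝒴) × 𝒴 => ∫⁻ θ, f z.2 θ ∂posteriorLaw prior p n z.1) = fun z =>
      (∫⁻ θ, likelihood p n z.1 θ ∂prior)⁻¹ * ∫⁻ θ, likelihood p n z.1 θ * f z.2 θ ∂prior := by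
    funext z
    exact lintegral_posteriorLaw hp n z.1 (hf.comp (measurable_const.prodMk measurable_id))
  rw [hrw]
  refine Measurable.mul (Measurable.inv ?_) ?_
  · exact (Measurable.lintegral_prod_right (measurable_likelihood_joint hp n)).comp measurable_fst
  · refine Measurable.lintegral_prod_right
      (f := fun (z : (ℕ → 𝒴) × 𝒴) (θ : Θ) => likelihood p n z.1 θ * f z.2 θ) (Measurable.mul ?_ ?_)
    · exact (measurable_likelihood_joint hp n).comp
        ((measurable_fst.comp measurable_fst).prodMk measurable_snd)
    · exact hf.comp ((measurable_snd.comp measurable_fst).prodMk measurable_snd)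

/-- The posterior mean of `|p_θ(y') - p_{θ₀}(y')|`, relative to `p_{θ₀}(y')`. -/
noncomputable def relDeviation (prior : Measure Θ) (p : Θ → 𝒴 → ℝ≥0) (θ₀ : Θ) (n : ℕ)
    (y : ℕ → 𝒴) (y' : 𝒴) : ℝ≥0∞ :=
  (∫⁻ θ, edist (p θ y') (p θ₀ y') ∂posteriorLaw prior p n y) * (p θ₀ y' : ℝ≥0∞)⁻¹

theorem measurable_edist_density (hp : Measurable (Function.uncurry p)) (θ₀ : Θ) :
    Measurable (fun z : 𝒴 × Θ => edist (p z.2 z.1) (p θ₀ z.1)) :=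
  (hp.comp measurable_swap).edist (hp.comp (measurable_const.prodMk measurable_fst))

theorem measurable_inv_density (hp : Measurable (Function.uncurry p)) (θ₀ : Θ) :
    Measurable (fun y => (p θ₀ y : ℝ≥0∞)⁻¹) :=
  (measurable_coe_nnreal_ennreal.comp (hp.comp (measurable_const.prodMk measurable_id))).inv

theorem measurable_relDeviation [SFinite prior] (hp : Measurable (Function.uncurry p)) (θ₀ : Θ)
    (n : ℕ) : Measurable (Function.uncurry (relDeviation prior p θ₀ n)) :=
  (measurable_lintegral_posteriorLaw hp n (f := fun y θ => edist (p θ y) (p θ₀ y))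
    (measurable_edist_density hp θ₀)).mul ((measurable_inv_density hp θ₀).comp measurable_snd)

/-- When the relative deviation of the new likelihood factor is small, updating the posterior moves
the mass of every event little. -/
theorem posteriorLaw_succ_close (hp : Measurable (Function.uncurry p)) {θ₀ : Θ} {n : ℕ} {y : ℕ → 𝒴}
    (h0 : evidence prior p n y ≠ 0) (htop : evidence prior p n y ≠ ∞) (hpos : 0 < p θ₀ (y n))
    (hsmall : relDeviation prior p θ₀ n y (y n) < 2⁻¹) (A : Set Θ) (hA : MeasurableSet A) :
    posteriorLaw prior p (n + 1) y A ≤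
        posteriorLaw prior p n y A + 4 * relDeviation prior p θ₀ n y (y n) ∧
      posteriorLaw prior p n y A ≤
        posteriorLaw prior p (n + 1) y A + 4 * relDeviation prior p θ₀ n y (y n) := by
  have := isProbabilityMeasure_posteriorLaw h0 htop
  set μ := posteriorLaw prior p n y with hμ
  set a : ℝ≥0∞ := (p θ₀ (y n) : ℝ≥0∞) with ha
  set D := ∫⁻ θ, edist (p θ (y n)) (p θ₀ (y n)) ∂μ with hD
  have ha0 : a ≠ 0 := by simpa [ha] using hpos.ne'
  have hatop : a ≠ ∞ := ENNReal.coe_ne_top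
  have hR : relDeviation prior p θ₀ n y (y n) = D * a⁻¹ := rfl
  rw [hR] at hsmall ⊢
  have hDa : D ≤ a / 2 := by
    have hmul := mul_le_mul_left hsmall.le a
    rwa [mul_assoc, ENNReal.inv_mul_cancel ha0 hatop, mul_one, mul_comm, ← div_eq_mul_inv] at hmul
  have hDtop : D ≠ ∞ := ne_top_of_le_ne_top (ENNReal.div_ne_top hatop (by simp)) hDa
  have hgm := measurable_coe_density hp (y n)
  have hdm : Measurable fun θ => edist (p θ (y n)) (p θ₀ (y n)) :=
    (measurable_edist_density hp θ₀).comp (measurable_const.prodMk measurable_id)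
  set c := ∫⁻ θ, (p θ (y n) : ℝ≥0∞) ∂μ with hc
  have h₁ : ∀ θ, (p θ (y n) : ℝ≥0∞) ≤ a + edist (p θ (y n)) (p θ₀ (y n)) :=
    fun θ => NNReal.coe_le_coe_add_edist _ _
  have h₂ : ∀ θ, a ≤ p θ (y n) + edist (p θ (y n)) (p θ₀ (y n)) := fun θ => by
    rw [edist_comm]; exact NNReal.coe_le_coe_add_edist _ _
  have hac : a ≤ c + D := by
    have hmono := lintegral_mono (μ := μ) h₂
    rwa [lintegral_const, measure_univ, mul_one, lintegral_add_left hgm] at hmono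
  have hca : c ≤ a + D := by
    have hmono := lintegral_mono (μ := μ) h₁
    rwa [lintegral_add_left measurable_const, lintegral_const, measure_univ, mul_one] at hmono
  -- The normalizing constant satisfies `c ≥ a - D ≥ a / 2`; this turns `2 * D / c` into `4 * D /
  -- a`.
  have hhalf : a / 2 ≤ c := by
    have hle : a / 2 + a / 2 ≤ c + a / 2 := by
      rw [ENNReal.add_halves]; exact hac.trans (by gcongr)
    exact (ENNReal.add_le_add_iff_right (ENNReal.div_ne_top hatop (by simp))).mp hle
  have hc0 : c ≠ 0 := (lt_of_lt_of_le (ENNReal.half_pos ha0) hhalf).ne'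
  have hctop : c ≠ ∞ := ne_top_of_le_ne_top (ENNReal.add_ne_top.mpr ⟨hatop, hDtop⟩) hca
  have hbound : 2 * D / c ≤ 4 * (D * a⁻¹) := by
    calc 2 * D / c ≤ 2 * D / (a / 2) := by gcongr
      _ = 4 * (D * a⁻¹) := by
        rw [div_eq_mul_inv, div_eq_mul_inv, ENNReal.mul_inv (Or.inl ha0) (Or.inl hatop), inv_inv]
        ring
  have hclose := reweight_close hgm rfl hc0 hctop h₁ h₂ A hA
  rw [posteriorLaw_succ hp h0 htop]
  exact ⟨hclose.1.trans (by gcongr), hclose.2.trans (by gcongr)⟩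

end Posterior

/-! ### From an independent copy to the next observation. -/

section Transfer

variable {Ω 𝒴 : Type*} [MeasurableSpace Ω] [MeasurableSpace 𝒴]

/-- In an i.i.d. sequence, the pair of the first `n` observations and the next one has the law of
the first `n` observations and an independent copy. -/
theorem measure_next_eq_prod {Pr : Measure Ω} [IsProbabilityMeasure Pr] {P₀ : Measure 𝒴}
    [IsProbabilityMeasure P₀] {Y : ℕ → Ω → 𝒴} (hY_law : ∀ i, HasLaw (Y i) P₀ Pr)
    (hY_indep : iIndepFun Y Pr) (n : ℕ) {f : (ℕ → 𝒴) → 𝒴 → ℝ≥0∞}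
    (hf : Measurable (Function.uncurry f))
    (hcongr : ∀ y y', (∀ i < n, y i = y' i) → f y = f y') (δ : ℝ≥0∞) :
    Pr {ω | δ ≤ f (fun i => Y i ω) (Y n ω)} =
      (Pr.prod P₀) {z | δ ≤ f (fun i => Y i z.1) z.2} := by
  classical
  have hYm : ∀ i, AEMeasurable (Y i) Pr := fun i => (hY_law i).aemeasurable
  let U : Ω → (Finset.range n → 𝒴) := fun ω i => Y i ω
  have hU : AEMeasurable U Pr := aemeasurable_pi_lambda _ fun i => hYm i
  -- Coordinates from `n` on are filled with the new observation, an arbitrary choice that `f`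
  -- cannot see by `hcongr`. Both events become preimages of one set `S` under pairs with the same
  -- law.
  let ext : (Finset.range n → 𝒴) × 𝒴 → ℕ → 𝒴 :=
    fun z i => if h : i ∈ Finset.range n then z.1 ⟨i, h⟩ else z.2
  have hext : Measurable ext := by
    refine measurable_pi_lambda _ fun i => ?_
    by_cases h : i ∈ Finset.range n
    · simp only [ext, h, dite_true]
      exact (measurable_pi_apply _).comp measurable_fst
    · simp only [ext, h, dite_false]
      exact measurable_snd
  let S : Set ((Finset.range n → 𝒴) × 𝒴) := {z | δ ≤ f (ext z) z.2}
  have hS : MeasurableSet S :=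
    measurableSet_le measurable_const (hf.comp (hext.prodMk measurable_snd))
  have hf_ext : ∀ ω y, f (ext (U ω, y)) = f (fun i => Y i ω) := by
    refine fun ω y => hcongr _ _ fun i hi => ?_
    simp [ext, U, hi]
  have hind : IndepFun U (Y n) Pr := by
    have hdisj := hY_indep.indepFun_finset₀ (Finset.range n) {n} (by simp) hYm
    exact hdisj.comp (φ := id) (ψ := fun v : ({n} : Finset ℕ) → 𝒴 => v ⟨n, by simp⟩)
      measurable_id (measurable_pi_apply _)
  have hlaw : Pr.map (fun ω => (U ω, Y n ω)) = (Pr.map U).prod P₀ := by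
    rw [(indepFun_iff_map_prod_eq_prod_map_map hU (hYm n)).mp hind, (hY_law n).map_eq]
  have hU' : AEMeasurable (fun z : Ω × 𝒴 => U z.1) (Pr.prod P₀) := hU.comp_fst
  have hlaw' : (Pr.prod P₀).map (fun z => (U z.1, z.2)) = (Pr.map U).prod P₀ := by
    have hprod : IndepFun (fun z : Ω × 𝒴 => U z.1) (fun z : Ω × 𝒴 => id z.2) (Pr.prod P₀) :=
      indepFun_prod₀ hU aemeasurable_id
    have hmap := (indepFun_iff_map_prod_eq_prod_map_map hU' measurable_snd.aemeasurable).mp hprod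
    have hfst : (Pr.prod P₀).map (fun z => U z.1) = Pr.map U := by
      have hmm := AEMeasurable.map_map_of_aemeasurable (μ := Pr.prod P₀) (f := Prod.fst) (g := U)
        (by rwa [measurePreserving_fst.map_eq]) measurable_fst.aemeasurable
      rw [measurePreserving_fst.map_eq] at hmm
      exact hmm.symm
    rwa [hfst, measurePreserving_snd.map_eq] at hmap
  have e₁ : Pr {ω | δ ≤ f (fun i => Y i ω) (Y n ω)} = (Pr.map U).prod P₀ S := by
    rw [← hlaw, Measure.map_apply_of_aemeasurable (hU.prodMk (hYm n)) hS]
    simp only [S, Set.preimage_ofPred_eq, hf_ext]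
  have e₂ : (Pr.prod P₀) {z | δ ≤ f (fun i => Y i z.1) z.2} = (Pr.map U).prod P₀ S := by
    rw [← hlaw', Measure.map_apply_of_aemeasurable (hU'.prodMk measurable_snd.aemeasurable) hS]
    simp only [S, Set.preimage_ofPred_eq, hf_ext]
  rw [e₁, e₂]

end Transfer

/-! ### The relative deviation vanishes in probability. -/

section Deviation

variable {Θ 𝒴 Ω : Type*} [NormedAddCommGroup Θ] [NormedSpace ℝ Θ] [MeasurableSpace Θ]
  [MeasurableSpace 𝒴] [MeasurableSpace Ω]

/-- The maximum is nonnegative because `a` is, so the absolute value leaves it unchanged. -/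
theorem le_abs_max (a : ℝ≥0∞) (b : EReal) : a ≤ (max (a : EReal) b).abs := by
  have hnonneg : (0 : EReal) ≤ max (a : EReal) b := le_max_of_le_left (EReal.coe_ennreal_nonneg a)
  have hle : (a : EReal) ≤ max (a : EReal) b := le_max_left _ _
  induction h : max (a : EReal) b with
  | bot => simp
  | top => simp
  | coe x =>
    rw [h] at hnonneg hle
    rw [EReal.abs_def, abs_of_nonneg (by exact_mod_cast hnonneg)]
    have := EReal.toENNReal_le_toENNReal hle
    simpa using this

theorem isProbabilityMeasure_sampling {ν : Measure 𝒴} {p : Θ → 𝒴 → ℝ≥0} {θ : Θ}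
    (h : ∫⁻ y, (p θ y : ℝ≥0∞) ∂ν = 1) : IsProbabilityMeasure (sampling ν p θ) :=
  ⟨by simp [sampling, h]⟩

theorem measurableSet_far [BorelSpace Θ] (θ₀ : Θ) (r : ℝ) : MeasurableSet (far θ₀ r) :=
  (isOpen_lt continuous_const (continuous_id.sub continuous_const).norm).measurableSet

theorem continuousAt_of_hasFDerivAt_log {f : Θ → ℝ≥0} {θ₀ : Θ} {A : Θ →L[ℝ] ℝ}
    (hpos : ∀ᶠ θ in 𝓝 θ₀, 0 < f θ) (hA : HasFDerivAt (fun θ => Real.log (f θ)) A θ₀) :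
    ContinuousAt f θ₀ := by
  have hexp : ContinuousAt (fun θ => Real.exp (Real.log (f θ))) θ₀ :=
    Real.continuous_exp.continuousAt.comp hA.continuousAt
  have hcoe : ContinuousAt (fun θ => (f θ : ℝ)) θ₀ := by
    refine hexp.congr ?_
    filter_upwards [hpos] with θ hθ
    exact Real.exp_log (by exact_mod_cast hθ)
  exact NNReal.isEmbedding_coe.continuousAt_iff.mpr hcoe

/-- Where the likelihood is continuous at `θ₀` and positive, the contribution of shrinking
neighbourhoods to the relative deviation vanishes, uniformly over sub-probability measures. -/
theorem tendsto_near_deviation {μ : ℕ → Measure Θ} (hμ : ∀ n, μ n Set.univ ≤ 1) {f : Θ → ℝ≥0}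
    {θ₀ : Θ} (hf : ContinuousAt f θ₀) (hpos : 0 < f θ₀) {r : ℕ → ℝ} (hr : Tendsto r atTop (𝓝 0)) :
    Tendsto (fun n => (∫⁻ θ, (far θ₀ (r n))ᶜ.indicator (fun θ => edist (f θ) (f θ₀)) θ ∂μ n) *
      (f θ₀ : ℝ≥0∞)⁻¹) atTop (𝓝 0) := by
  have hb0 : (f θ₀ : ℝ≥0∞) ≠ 0 := by simpa using hpos.ne'
  rw [ENNReal.tendsto_atTop_zero]
  intro η hη
  have hev : ∀ᶠ θ in 𝓝 θ₀, edist (f θ) (f θ₀) ≤ η * f θ₀ := by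
    have hlim := tendsto_iff_edist_tendsto_0.mp hf.tendsto
    -- The tolerance carries the factor `f θ₀` so that the final division leaves exactly `η`.
    exact hlim.eventually (ge_mem_nhds (ENNReal.mul_pos hη.ne' hb0))
  obtain ⟨s, hs, hball⟩ := Metric.eventually_nhds_iff.mp hev
  obtain ⟨N, hN⟩ := eventually_atTop.mp (hr.eventually (gt_mem_nhds hs))
  refine ⟨N, fun n hn => ?_⟩
  calc _ ≤ (∫⁻ _, η * f θ₀ ∂μ n) * (f θ₀ : ℝ≥0∞)⁻¹ := by
        gcongr with θ
        refine Set.indicator_le' (fun θ hθ => hball ?_) (fun _ _ => zero_le) θ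
        rw [dist_eq_norm]
        exact (show ‖θ - θ₀‖ ≤ r n by simpa [far] using hθ).trans_lt (hN n hn)
    _ ≤ (η * f θ₀ * 1) * (f θ₀ : ℝ≥0∞)⁻¹ := by
        rw [lintegral_const]; gcongr; exact hμ n
    _ = η := by rw [mul_one, mul_assoc, ENNReal.mul_inv_cancel hb0 ENNReal.coe_ne_top, mul_one]

/-- The relative deviation of the likelihood of an independent new observation tends to `0` in
probability under the posterior. -/
theorem tendstoZeroInProb_relDeviation [BorelSpace Θ] {prior : Measure Θ} [SFinite prior]
    {p : Θ → 𝒴 → ℝ≥0} (hp : Measurable (Function.uncurry p)) {θ₀ : Θ} {P₀ : Measure 𝒴}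
    [IsProbabilityMeasure P₀] {Pr : Measure Ω} [IsProbabilityMeasure Pr] {Y : ℕ → Ω → 𝒴}
    (hY : ∀ i, AEMeasurable (Y i) Pr) {M : ℝ} {ε : ℕ → ℝ} (hε : Tendsto ε atTop (𝓝 0))
    (h_rate : ContractsAtRate Pr Y prior p θ₀ M ε) (h_tail : TailCondition Pr Y prior p P₀ θ₀ M ε)
    (h_diff : LogLikelihoodDifferentiable p P₀ θ₀) :
    TendstoZeroInProb (Pr.prod P₀)
      (fun n z => relDeviation prior p θ₀ n (fun i => Y i z.1) z.2) := by
  obtain ⟨A, hA, -⟩ := h_diff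
  have hgood : ∀ᵐ z : Ω × 𝒴 ∂(Pr.prod P₀), (∀ᶠ θ in 𝓝 θ₀, 0 < p θ z.2) ∧
      HasFDerivAt (fun θ => Real.log (p θ z.2)) (A z.2) θ₀ :=
    Measure.quasiMeasurePreserving_snd.ae hA
  have hpos : ∀ᵐ z : Ω × 𝒴 ∂(Pr.prod P₀), 0 < p θ₀ z.2 := hgood.mono fun z hz => hz.1.self_of_nhds
  have hr : Tendsto (fun n => M * ε n) atTop (𝓝 0) := by simpa using hε.const_mul M
  have hsample : AEMeasurable (fun z : Ω × 𝒴 => ((fun i => Y i z.1 : ℕ → 𝒴), z.2)) (Pr.prod P₀) :=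
    (aemeasurable_pi_lambda _ fun i => (hY i).comp_fst).prodMk measurable_snd.aemeasurable
  have hinv : Measurable fun z : Ω × 𝒴 => (p θ₀ z.2 : ℝ≥0∞)⁻¹ :=
    (measurable_inv_density hp θ₀).comp measurable_snd
  let near : ℕ → (ℕ → 𝒴) × 𝒴 → ℝ≥0∞ := fun n z =>
    ∫⁻ θ, (far θ₀ (M * ε n))ᶜ.indicator (fun θ => edist (p θ z.2) (p θ₀ z.2)) θ
      ∂posteriorLaw prior p n z.1
  have hnear_meas : ∀ n, Measurable (near n) := fun n => by
    refine measurable_lintegral_posteriorLaw hp n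
      (f := fun y θ => (far θ₀ (M * ε n))ᶜ.indicator (fun θ => edist (p θ y) (p θ₀ y)) θ) ?_
    exact (measurable_edist_density hp θ₀).indicator
      (measurable_snd (measurableSet_far θ₀ (M * ε n)).compl)
  have hnear : TendstoZeroInProb (Pr.prod P₀)
      (fun n z => near n (fun i => Y i z.1, z.2) * (p θ₀ z.2 : ℝ≥0∞)⁻¹) := by
    refine tendstoZeroInProb_of_tendsto_ae
      (fun n => ((hnear_meas n).comp_aemeasurable hsample).mul hinv.aemeasurable) ?_
    filter_upwards [hgood] with z hz
    exact tendsto_near_deviation (fun n => posteriorLaw_le_one n _ _)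
      (continuousAt_of_hasFDerivAt_log hz.1 hz.2) hz.1.self_of_nhds hr
  have hmass : TendstoZeroInProb (Pr.prod P₀) (fun n z =>
      posteriorLaw prior p n (fun i => Y i z.1) (far θ₀ (M * ε n))) := by
    intro δ hδ
    refine (h_rate δ hδ).congr fun n => ?_
    -- The event ignores the new observation, so it is a rectangle whose second side is the whole
    -- space.
    have hprod : {z : Ω × 𝒴 | δ ≤ posteriorLaw prior p n (fun i => Y i z.1) (far θ₀ (M * ε n))} =
        {ω | δ ≤ posteriorLaw prior p n (fun i => Y i ω) (far θ₀ (M * ε n))} ×ˢ Set.univ := by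
      ext z; simp
    rw [hprod, Measure.prod_prod, measure_univ, mul_one]
  have htail : TendstoZeroInProb (Pr.prod P₀) (fun n z =>
      tailDensity p (posteriorLaw prior p n (fun i => Y i z.1)) (far θ₀ (M * ε n)) z.2 *
        (p θ₀ z.2 : ℝ≥0∞)⁻¹) := by
    -- The factor `1 / p θ₀ z.2` does not depend on `n` and is a.s. finite.
    refine (TendstoZeroInProb.mono h_tail fun n => ae_of_all _ fun z => le_abs_max _ _).mul_const
      hinv.aemeasurable ?_
    filter_upwards [hpos] with z hz
    simpa using hz.ne'
  refine TendstoZeroInProb.mono (hnear.add (htail.add hmass)) fun n => ?_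
  filter_upwards [hpos] with z hz
  have hb0 : (p θ₀ z.2 : ℝ≥0∞) ≠ 0 := by simpa using hz.ne'
  set μ := posteriorLaw prior p n (fun i => Y i z.1) with hμ
  have hF := measurableSet_far θ₀ (M * ε n)
  have hfar : ∫⁻ θ in far θ₀ (M * ε n), edist (p θ z.2) (p θ₀ z.2) ∂μ ≤
      tailDensity p μ (far θ₀ (M * ε n)) z.2 + μ (far θ₀ (M * ε n)) * p θ₀ z.2 := by
    calc _ ≤ ∫⁻ θ in far θ₀ (M * ε n), ((p θ z.2 : ℝ≥0∞) + p θ₀ z.2) ∂μ :=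
          lintegral_mono fun θ => NNReal.edist_le_coe_add _ _
      _ = _ := by
          rw [lintegral_add_right _ measurable_const, setLIntegral_const, mul_comm (p θ₀ z.2 : ℝ≥0∞)]; rfl
  calc relDeviation prior p θ₀ n (fun i => Y i z.1) z.2
      = (near n (fun i => Y i z.1, z.2) +
          ∫⁻ θ in far θ₀ (M * ε n), edist (p θ z.2) (p θ₀ z.2) ∂μ) * (p θ₀ z.2 : ℝ≥0∞)⁻¹ := by
        simp only [near, relDeviation]
        rw [lintegral_indicator hF.compl, add_comm, lintegral_add_compl _ hF]
    _ ≤ (near n (fun i => Y i z.1, z.2) + (tailDensity p μ (far θ₀ (M * ε n)) z.2 +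
          μ (far θ₀ (M * ε n)) * p θ₀ z.2)) * (p θ₀ z.2 : ℝ≥0∞)⁻¹ := by gcongr
    _ = _ := by
        rw [add_mul, add_mul, mul_assoc (μ _), ENNReal.mul_inv_cancel hb0 ENNReal.coe_ne_top,
          mul_one]

end Deviation

end BayesModel

/-! ### Stability of the full and marginal posteriors. -/

theorem mainTheorem10
    {Θ 𝒴 Ω : Type*}
    [NormedAddCommGroup Θ] [NormedSpace ℝ Θ] [CompleteSpace Θ]
    [MeasurableSpace Θ] [BorelSpace Θ] [MeasurableSpace 𝒴] [MeasurableSpace Ω]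
    (prior : Measure Θ) [IsProbabilityMeasure prior]
    (ν : Measure 𝒴) (p : Θ → 𝒴 → ℝ≥0)
    (hp_meas : Measurable (Function.uncurry p))
    (hp_density : ∀ θ, ∫⁻ y, (p θ y : ℝ≥0∞) ∂ν = 1)
    (θ₀ : Θ)
    (Pr : Measure Ω) [IsProbabilityMeasure Pr]
    (Y : ℕ → Ω → 𝒴)
    (hY_law : ∀ i, HasLaw (Y i) (BayesModel.sampling ν p θ₀) Pr)
    (hY_indep : iIndepFun Y Pr)
    (h_posterior : ∀ n, ∀ᵐ ω ∂Pr,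
      BayesModel.evidence prior p n (fun i => Y i ω) ≠ 0 ∧
      BayesModel.evidence prior p n (fun i => Y i ω) ≠ ∞)
    (M : ℝ) (hM : 0 < M) (ε : ℕ → ℝ) (hε : Tendsto ε atTop (𝓝 0))
    (h_rate : BayesModel.ContractsAtRate Pr Y prior p θ₀ M ε)
    (h_tail : BayesModel.TailCondition Pr Y prior p (BayesModel.sampling ν p θ₀) θ₀ M ε)
    (h_diff : BayesModel.LogLikelihoodDifferentiable p (BayesModel.sampling ν p θ₀) θ₀) :
    BayesModel.TendstoZeroInProb Pr (fun n ω =>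
      BayesModel.l1Dist
        (BayesModel.posteriorLaw prior p (n + 1) (fun i => Y i ω))
        (BayesModel.posteriorLaw prior p n (fun i => Y i ω))) ∧
    ∀ (d₀ : ℕ) (ξ : Θ → EuclideanSpace ℝ (Fin d₀)), Measurable ξ →
      BayesModel.TendstoZeroInProb Pr (fun n ω =>
        BayesModel.l1Dist
          ((BayesModel.posteriorLaw prior p (n + 1) (fun i => Y i ω)).map ξ)
          ((BayesModel.posteriorLaw prior p n (fun i => Y i ω)).map ξ)) := by
  have := BayesModel.isProbabilityMeasure_sampling (hp_density θ₀)
  have hY : ∀ i, AEMeasurable (Y i) Pr := fun i => (hY_law i).aemeasurable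
  have hdev : BayesModel.TendstoZeroInProb Pr (fun n ω =>
      BayesModel.relDeviation prior p θ₀ n (fun i => Y i ω) (Y n ω)) := by
    intro δ hδ
    refine (BayesModel.tendstoZeroInProb_relDeviation hp_meas hY hε h_rate h_tail h_diff
      δ hδ).congr fun n => ?_
    refine (BayesModel.measure_next_eq_prod hY_law hY_indep n
      (BayesModel.measurable_relDeviation hp_meas θ₀ n) (fun y y' h => ?_) δ).symm
    funext y₁
    rw [BayesModel.relDeviation, BayesModel.relDeviation, BayesModel.posteriorLaw_congr h]
  have hpos : ∀ n, ∀ᵐ ω ∂Pr, 0 < p θ₀ (Y n ω) := by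
    intro n
    obtain ⟨A, hA, -⟩ := h_diff
    rw [← (hY_law n).map_eq] at hA
    filter_upwards [ae_of_ae_map (hY n) hA] with ω hω
    exact hω.1.self_of_nhds
  -- Any quantity bounded by twice the largest change of mass of an event tends to `0`; this serves
  -- the full posterior and the marginals at once.
  have hconclude : ∀ L : ℕ → Ω → ℝ≥0∞,
      (∀ n ω, IsProbabilityMeasure (BayesModel.posteriorLaw prior p (n + 1) (fun i => Y i ω)) →
        IsProbabilityMeasure (BayesModel.posteriorLaw prior p n (fun i => Y i ω)) →
        ∀ K, (∀ A, MeasurableSet A →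
          BayesModel.posteriorLaw prior p (n + 1) (fun i => Y i ω) A ≤
            BayesModel.posteriorLaw prior p n (fun i => Y i ω) A + K ∧
          BayesModel.posteriorLaw prior p n (fun i => Y i ω) A ≤
            BayesModel.posteriorLaw prior p (n + 1) (fun i => Y i ω) A + K) →
        L n ω ≤ 2 * K) →
      BayesModel.TendstoZeroInProb Pr L := by
    intro L hL δ hδ
    refine tendsto_of_tendsto_of_tendsto_of_le_of_le tendsto_const_nhds
      -- Here `8 = 2 * 4`, from `L ≤ 2 * K` with `K` four times the deviation; `2⁻¹` is the
      -- threshold of `posteriorLaw_succ_close`.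
      (hdev (min (δ / 8) 2⁻¹) (lt_min (ENNReal.div_pos hδ.ne' (by simp)) (by simp)))
      (fun _ => zero_le) (fun n => measure_mono_ae ?_)
    filter_upwards [h_posterior n, h_posterior (n + 1), hpos n] with ω h h' hω hδω
    by_contra hlt
    obtain ⟨hlt8, hlt2⟩ := lt_min_iff.mp (not_le.mp hlt)
    have hle := hL n ω (BayesModel.isProbabilityMeasure_posteriorLaw h'.1 h'.2)
      (BayesModel.isProbabilityMeasure_posteriorLaw h.1 h.2) _
      (fun A hA => BayesModel.posteriorLaw_succ_close hp_meas h.1 h.2 hω hlt2 A hA)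
    rw [ENNReal.lt_div_iff_mul_lt (by simp) (by simp)] at hlt8
    refine absurd (le_trans hδω hle) (not_le.mpr (lt_of_eq_of_lt ?_ hlt8))
    ring
  refine ⟨hconclude _ fun n ω _ _ K hK => BayesModel.l1Dist_le_two_mul
    (fun A hA => (hK A hA).1) (fun A hA => (hK A hA).2), fun d₀ ξ hξ => ?_⟩
  refine hconclude _ fun n ω _ _ K hK => BayesModel.l1Dist_le_two_mul (fun A hA => ?_)
    (fun A hA => ?_)
  -- Marginal events are the posterior events `ξ ⁻¹' A`.
  · rw [Measure.map_apply hξ hA, Measure.map_apply hξ hA]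
    exact (hK _ (hξ hA)).1
  · rw [Measure.map_apply hξ hA, Measure.map_apply hξ hA]
    exact (hK _ (hξ hA)).2
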